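/- Let $N\ge 1$, $Q=(0,1)^N$, and let $k\ge 0$ be an integer. For $s\in(0,1)$ and $w:(0,1)\to\mathbb R$ let $$d^s_R w(x)=-\frac1{\Gamma(1-s)}\frac{d}{dx}\int_x^1\frac{w(t)}{(t-x)^s}\,dt$$ be the right-sided Riemann–Liouville derivative, let $\partial^s_{i,R}$ be this operator acting in the variable $x_i$, and for a vector field $\psi$ on $Q$ put $\operatorname{div}^s\psi=\big[(1-\tfrac1N)s+\tfrac1N\big]\sum_{i=1}^N\partial^s_{i,R}\psi_i$. For $\varphi\in C_c^\infty(Q;\mathbb R^{N\times N^k})$ let $\operatorname{div}^k\varphi$ be the vector field $(\operatorname{div}^k\varphi)_i=\sum_{j_1,\dots,j_k=1}^N\partial_{j_1}\cdots\partial_{j_k}\varphi_{i,(j_1,\dots,j_k)}$ (so $\operatorname{div}^0\varphi=\varphi$). For $p\in[1,\infty]$ and $u\in L^1(Q)$ define $$TV^{k+s}_{\ell^p}(u)=\sup\Big\{\int_Q u\,\operatorname{div}^s[\operatorname{div}^k\varphi]\,dx:\ \varphi\in C_c^\infty(Q;\mathbb R^{N\times N^k}),\ |\varphi|^*_{\ell^p}\le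 1\text{ on }Q\Big\}\in[0,\infty],$$ where $|\cdot|^*_{\ell^p}$ is the norm dual to the entrywise $\ell^p$ norm. Let $SV^{k+s}(Q)$ be the set of all $u\in L^1(Q)$ such that, for every $p\in[1,\infty]$, $TV^{k+s}_{\ell^p}(u)<\infty$ and there are $u_n\in C^\infty(Q)\cap L^1(Q)$ with $TV^{k+s}_{\ell^p}(u_n)<\infty$, $u_n\to u$ in $L^1(Q)$ and $TV^{k+s}_{\ell^p}(u_n)\to TV^{k+s}_{\ell^p}(u)$. Then there is a constant $C>0$, depending only on $N$ and $k$, such that for all $p\in[1,\infty]$, all $s\in(0,1)$ and all $u\in SV^{k+s}(Q)$, $$TV^{s}_{\ell^p}(u)\le C\big(\|u\|_{L^1(Q)}+TV^{k+s}_{\ell^p}(u)\big).$$ -/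

import Mathlib

open MeasureTheory Filter Topology Set
open scoped ENNReal ContDiff

noncomputable section

namespace FracTV

/-- The open unit cube `Q = (0,1)^N`. -/
def unitCube (N : ℕ) : Set (Fin N → ℝ) := {x | ∀ i, x i ∈ Ioo (0 : ℝ) 1}

/-- The right-sided Riemann-Liouville derivative of order `s ∈ (0,1)` on the unit interval:
`d_R^s w (x) = - 1 / Γ(1-s) * d/dx ∫_x^1 w(t) / (t-x)^s dt`. -/
def rlDerivRight (s : ℝ) (w : ℝ → ℝ) (x : ℝ) : ℝ :=
  -(1 / Real.Gamma (1 - s)) * deriv (fun y : ℝ => ∫ t in y..1, w t / (t - y) ^ s) x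

/-- The partial derivative `∂_i f`. -/
def partialDeriv {N : ℕ} (i : Fin N) (f : (Fin N → ℝ) → ℝ) (x : Fin N → ℝ) : ℝ :=
  deriv (fun t : ℝ => f (Function.update x i t)) (x i)

/-- The right-sided fractional partial derivative `∂_{i,R}^s f`: the one-dimensional derivative of
order `s` in the `i`-th variable, the other variables being frozen. -/
def fracPartialDerivRight {N : ℕ} (s : ℝ) (i : Fin N) (f : (Fin N → ℝ) → ℝ)
    (x : Fin N → ℝ) : ℝ :=
  rlDerivRight s (fun t : ℝ => f (Function.update x i t)) (x i)

/-- The scaled fractional divergence of a vector field,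
`div^s φ = [(1 - 1/N) s + 1/N] ∑ i, ∂_{i,R}^s φ_i`. -/
def fracDiv {N : ℕ} (s : ℝ) (φ : (Fin N → ℝ) → Fin N → ℝ) (x : Fin N → ℝ) : ℝ :=
  ((1 - 1 / (N : ℝ)) * s + 1 / (N : ℝ)) *
    ∑ i, fracPartialDerivRight s i (fun y => φ y i) x

/-- Indices of the entries of an `N × N^k` matrix (a tensor of order `k + 1`). -/
abbrev TensorIndex (N k : ℕ) : Type := Fin N × (Fin k → Fin N)

/-- The iterated divergence `div^k`, which turns a field of `N × N^k` matrices into a vector field: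
each step is the row-wise divergence, that is, it contracts the last index with the gradient.
Explicitly, `(div^k φ)_i = ∑_j ∂_{j_1} ⋯ ∂_{j_k} φ_{i, (j_1, …, j_k)}`. -/
def divIter {N : ℕ} : (k : ℕ) → ((Fin N → ℝ) → TensorIndex N k → ℝ) → (Fin N → ℝ) → Fin N → ℝ
  | 0, φ => fun x i => φ x (i, Fin.elim0)
  | k + 1, φ => divIter k (fun x a =>
      ∑ l : Fin N, partialDeriv l (fun y => φ y (a.1, (Fin.snoc a.2 l : Fin (k + 1) → Fin N))) x)

/-- The norm dual to the `ℓ^p` norm on `ℝ^ι`, with respect to the Euclidean pairing. -/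
def dualNorm {ι : Type} [Fintype ι] (p : ℝ≥0∞) [Fact (1 ≤ p)] (y : ι → ℝ) : ℝ :=
  sSup ((fun x : PiLp p (fun _ : ι => ℝ) => ∑ i, x i * y i) '' Metric.closedBall 0 1)

/-- The test fields: `φ ∈ C_c^∞(Q; M^{N × N^k})` whose dual `ℓ^p` norm is at most `1` everywhere. -/
def IsTestField {N : ℕ} (p : ℝ≥0∞) [Fact (1 ≤ p)] (k : ℕ)
    (φ : (Fin N → ℝ) → TensorIndex N k → ℝ) : Prop :=
  ContDiff ℝ ∞ φ ∧ HasCompactSupport φ ∧ tsupport φ ⊆ unitCube N ∧ ∀ x, dualNorm p (φ x) ≤ 1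

/-- The total variation `TV^r_{ℓ^p}(u)` of order `r = k + s` with `k = ⌊r⌋` and `s ∈ (0,1)`,
the supremum of `∫_Q u div^s (div^k φ) dx` over all test fields `φ`. As `φ = 0` is a test field,
the supremum is nonnegative, so replacing negative integrals by `0` does not change it. -/
def TV {N : ℕ} (p : ℝ≥0∞) [Fact (1 ≤ p)] (k : ℕ) (s : ℝ) (u : (Fin N → ℝ) → ℝ) : ℝ≥0∞ :=
  ⨆ (φ : (Fin N → ℝ) → TensorIndex N k → ℝ) (_ : IsTestField p k φ),
    ENNReal.ofReal (∫ x in unitCube N, u x * fracDiv s (divIter k φ) x)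

/-- Strict convergence `v n → u` with respect to the seminorm `TV^{k+s}_{ℓ^p}`: convergence in
`L^1(Q)` together with convergence of the (finite) total variations. -/
def StrictConv {N : ℕ} (p : ℝ≥0∞) [Fact (1 ≤ p)] (k : ℕ) (s : ℝ)
    (v : ℕ → (Fin N → ℝ) → ℝ) (u : (Fin N → ℝ) → ℝ) : Prop :=
  (∀ n, IntegrableOn (v n) (unitCube N) ∧ TV p k s (v n) < ⊤) ∧
  IntegrableOn u (unitCube N) ∧ TV p k s u < ⊤ ∧
  Tendsto (fun n => ∫ x in unitCube N, |v n x - u x|) atTop (𝓝 0) ∧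
  Tendsto (fun n => TV p k s (v n)) atTop (𝓝 (TV p k s u))

/-- Membership in `SV^{k+s}(Q)`, the intersection over all `p ∈ [1,∞]` of the closures of
`C^∞(Q)` with respect to strict convergence. -/
def MemSV {N : ℕ} (k : ℕ) (s : ℝ) (u : (Fin N → ℝ) → ℝ) : Prop :=
  ∀ (p : ℝ≥0∞) [Fact (1 ≤ p)], ∃ v : ℕ → (Fin N → ℝ) → ℝ,
    (∀ n, ContDiffOn ℝ ∞ (v n) (unitCube N)) ∧ StrictConv p k s v u

end FracTV

end

namespace FracTV

/-! The argument is by duality: each order-zero test field `ψ` is, up to a harmless error, a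
multiple of `div^k` of an admissible field. Only `∂_i^s` acts on the component `ψ_i`, so everything
can be done along lines in direction `i`. Subtract from `ψ_i` its mean on each such line times a
fixed bump in `x_i`; the rest has mean zero on every line, so its primitive again has compact
support. Iterating gives `ψ_i = ∂_i^k φ_i + η_i` with `φ_i` and `∂_i η_i` bounded in terms of `sup
|ψ_i|` (`exists_iterate_partialDeriv_add`). Transverse derivatives of `η_i` are not controlled, and
are not needed.

Placing `φ_i` at the diagonal index `(i, (i, …, i))` turns `div^k` into the pure derivatives `∂_i^k
φ_i` (`divIter_diagonal`), so after rescaling this part is bounded by `TV^{k+s}(u)`. The error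
satisfies `|∂_i^s η_i| ≤ sup |∂_i η_i| / Γ(2 - s)`, so it costs a multiple of the `L^1` norm. The
constant is uniform in `s` because `Γ` is bounded below on `[1, 2]`, and in `p` because every dual
norm lies between the maximum and the sum of the absolute entries. -/

/-! ### Smooth dependence of integrals on parameters -/

theorem contDiff_nat_intervalIntegral {E : Type} [NormedAddCommGroup E] [NormedSpace ℝ E]
    [FiniteDimensional ℝ E] (n : ℕ) :
    ∀ {F : Type} [NormedAddCommGroup F] [NormedSpace ℝ F] [CompleteSpace F] (f : E → ℝ → F),
      ContDiff ℝ n (Function.uncurry f) → ContDiff ℝ n (fun x => ∫ t in (0 : ℝ)..1, f x t) := by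
  induction n with
  | zero =>
    intro F _ _ _ f hf
    simp only [Nat.cast_zero, contDiff_zero] at hf ⊢
    exact intervalIntegral.continuous_parametric_intervalIntegral_of_continuous' hf 0 1
  | succ n ih =>
    intro F _ _ _ f hf
    have : ProperSpace E := FiniteDimensional.proper ℝ E
    have hf' : ContDiff ℝ n (Function.uncurry fun x t =>
        (fderiv ℝ (Function.uncurry f) (x, t)).comp (ContinuousLinearMap.inl ℝ E ℝ)) := by
      have h := hf.fderiv_right (m := (n : WithTop ℕ∞)) (by push_cast; exact le_rfl)
      exact h.clm_comp contDiff_const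
    have hdiff : ∀ x t, HasFDerivAt (fun x => f x t)
        ((fderiv ℝ (Function.uncurry f) (x, t)).comp (ContinuousLinearMap.inl ℝ E ℝ)) x := by
      intro x t
      have h1 : HasFDerivAt (Function.uncurry f) (fderiv ℝ (Function.uncurry f) (x, t)) (x, t) :=
        (hf.differentiable (by simp) (x, t)).hasFDerivAt
      exact HasFDerivAt.comp (f := fun e => (e, t)) x h1 (hasFDerivAt_prodMk_left x t)
    have hmain : ∀ x₀, HasFDerivAt (fun x => ∫ t in (0 : ℝ)..1, f x t)
        (∫ t in (0 : ℝ)..1, (fderiv ℝ (Function.uncurry f) (x₀, t)).comp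
          (ContinuousLinearMap.inl ℝ E ℝ)) x₀ := by
      intro x₀
      obtain ⟨B, hB⟩ := ((isCompact_closedBall x₀ 1).prod
        (isCompact_Icc (a := (0 : ℝ)) (b := 1))).exists_bound_of_continuousOn
        hf'.continuous.continuousOn
      have hc : ∀ x, Continuous (fun t => f x t) := fun x =>
        hf.continuous.comp (Continuous.prodMk_right x)
      refine intervalIntegral.hasFDerivAt_integral_of_dominated_of_fderiv_le
        (F' := fun x t => (fderiv ℝ (Function.uncurry f) (x, t)).comp
          (ContinuousLinearMap.inl ℝ E ℝ)) (bound := fun _ => B)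
        (Metric.closedBall_mem_nhds x₀ one_pos) ?_ ?_ ?_ ?_ ?_ ?_
      · exact Eventually.of_forall fun x => (hc x).aestronglyMeasurable
      · exact (hc x₀).intervalIntegrable _ _
      · exact (hf'.continuous.comp (Continuous.prodMk_right x₀)).aestronglyMeasurable
      · refine Eventually.of_forall fun t ht x hx => hB (x, t) ⟨hx, ?_⟩
        rw [uIoc_of_le zero_le_one] at ht
        exact ⟨ht.1.le, ht.2⟩
      · exact intervalIntegrable_const
      · exact Eventually.of_forall fun t _ x _ => hdiff x t
    push_cast
    rw [contDiff_succ_iff_fderiv]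
    refine ⟨fun x => (hmain x).differentiableAt, by simp, ?_⟩
    rw [show fderiv ℝ (fun x => ∫ t in (0 : ℝ)..1, f x t) = _ from funext fun x => (hmain x).fderiv]
    -- The derivative takes values in a space of linear maps, so the induction has to range over all
    -- target spaces `F`.
    exact ih _ hf'

/-- An integral over `[0,1]` of a jointly smooth integrand is smooth in the parameter. -/
theorem contDiff_intervalIntegral {E F : Type} [NormedAddCommGroup E] [NormedSpace ℝ E]
    [FiniteDimensional ℝ E] [NormedAddCommGroup F] [NormedSpace ℝ F] [CompleteSpace F]
    {f : E → ℝ → F} (hf : ContDiff ℝ ∞ (Function.uncurry f)) :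
    ContDiff ℝ ∞ (fun x => ∫ t in (0 : ℝ)..1, f x t) :=
  contDiff_infty.2 fun n => contDiff_nat_intervalIntegral n f (contDiff_infty.1 hf n)

/-! ### Partial derivatives and smooth functions supported in a box -/

variable {N : ℕ}

theorem hasDerivAt_comp_update {f : (Fin N → ℝ) → ℝ} (hf : ContDiff ℝ ∞ f) (i : Fin N)
    (x : Fin N → ℝ) (t : ℝ) :
    HasDerivAt (fun t => f (Function.update x i t)) (partialDeriv i f (Function.update x i t)) t := by
  have h (x : Fin N → ℝ) (t : ℝ) : HasDerivAt (fun t => f (Function.update x i t))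
      (fderiv ℝ f (Function.update x i t) (Pi.single i 1)) t :=
    ((hf.differentiable (by simp) _).hasFDerivAt).comp_hasDerivAt t (hasDerivAt_update x i t)
  convert h x t using 1
  simpa [partialDeriv] using (h (Function.update x i t) t).deriv

theorem partialDeriv_eq_fderiv {f : (Fin N → ℝ) → ℝ} (hf : ContDiff ℝ ∞ f) (i : Fin N) :
    partialDeriv i f = fun x => fderiv ℝ f x (Pi.single i 1) := by
  ext x
  have h := ((hf.differentiable (by simp) (Function.update x i (x i))).hasFDerivAt).comp_hasDerivAt
    (x i) (hasDerivAt_update x i (x i))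
  rw [Function.update_eq_self] at h
  exact h.deriv

theorem contDiff_partialDeriv {f : (Fin N → ℝ) → ℝ} (hf : ContDiff ℝ ∞ f) (i : Fin N) :
    ContDiff ℝ ∞ (partialDeriv i f) := by
  rw [partialDeriv_eq_fderiv hf]
  exact (hf.fderiv_right (m := ∞) (by simp)).clm_apply contDiff_const

theorem partialDeriv_add {f g : (Fin N → ℝ) → ℝ} (hf : ContDiff ℝ ∞ f) (hg : ContDiff ℝ ∞ g)
    (i : Fin N) : partialDeriv i (f + g) = partialDeriv i f + partialDeriv i g := by
  ext x
  have h1 := hasDerivAt_comp_update hf i x (x i)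
  have h2 := hasDerivAt_comp_update hg i x (x i)
  rw [Function.update_eq_self] at h1 h2
  exact (h1.add h2).deriv

theorem partialDeriv_const_mul (c : ℝ) (f : (Fin N → ℝ) → ℝ) (i : Fin N) :
    partialDeriv i (fun x => c * f x) = fun x => c * partialDeriv i f x := by
  ext x
  exact deriv_const_mul_field c

theorem partialDeriv_zero (i : Fin N) : partialDeriv i (0 : (Fin N → ℝ) → ℝ) = 0 := by
  ext x
  simp [partialDeriv]

/-- Smooth functions vanishing outside of the closed box `[δ, 1 - δ]^N`. -/
def SmoothInBox (δ : ℝ) (f : (Fin N → ℝ) → ℝ) : Prop :=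
  ContDiff ℝ ∞ f ∧ ∀ x, ∀ j, x j ∉ Icc δ (1 - δ) → f x = 0

namespace SmoothInBox

variable {δ : ℝ} {f g : (Fin N → ℝ) → ℝ}

theorem zero (δ : ℝ) : SmoothInBox δ (0 : (Fin N → ℝ) → ℝ) :=
  ⟨contDiff_const, fun _ _ _ => rfl⟩

theorem add (hf : SmoothInBox δ f) (hg : SmoothInBox δ g) : SmoothInBox δ (f + g) :=
  ⟨hf.1.add hg.1, fun x j hj => by simp [hf.2 x j hj, hg.2 x j hj]⟩

theorem const_mul (hf : SmoothInBox δ f) (c : ℝ) : SmoothInBox δ (fun x => c * f x) :=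
  ⟨contDiff_const.mul hf.1, fun x j hj => by simp [hf.2 x j hj]⟩

theorem partialDeriv (hf : SmoothInBox δ f) (i : Fin N) : SmoothInBox δ (partialDeriv i f) := by
  refine ⟨contDiff_partialDeriv hf.1 i, fun x j hj => ?_⟩
  rw [partialDeriv_eq_fderiv hf.1]
  have : f =ᶠ[𝓝 x] fun _ => 0 := by
    have ho : IsOpen {y : Fin N → ℝ | y j ∉ Icc δ (1 - δ)} :=
      (isClosed_Icc.preimage (continuous_apply j)).isOpen_compl
    filter_upwards [ho.mem_nhds hj] with y hy using hf.2 y j hy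
  simp [this.fderiv_eq]

theorem iterate_partialDeriv (hf : SmoothInBox δ f) (i : Fin N) (k : ℕ) :
    SmoothInBox δ ((FracTV.partialDeriv i)^[k] f) := by
  induction k with
  | zero => exact hf
  | succ k ih => rw [Function.iterate_succ_apply']; exact ih.partialDeriv i

theorem hasCompactSupport (hf : SmoothInBox δ f) : HasCompactSupport f := by
  have hts : tsupport f ⊆ Icc (fun _ => δ) (fun _ => 1 - δ) := by
    refine closure_minimal (fun x hx => ?_) isClosed_Icc
    have h : ∀ j, x j ∈ Icc δ (1 - δ) := fun j => by
      by_contra hj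
      exact hx (hf.2 x j hj)
    exact ⟨fun j => (h j).1, fun j => (h j).2⟩
  exact isCompact_Icc.of_isClosed_subset (isClosed_tsupport f) hts

theorem exists_bound (hf : SmoothInBox δ f) : ∃ M, ∀ x, |f x| ≤ M := by
  obtain ⟨M, hM⟩ := hf.hasCompactSupport.exists_bound_of_continuous hf.1.continuous
  exact ⟨M, hM⟩

end SmoothInBox

theorem iterate_partialDeriv_add {f g : (Fin N → ℝ) → ℝ} (hf : ContDiff ℝ ∞ f)
    (hg : ContDiff ℝ ∞ g) (i : Fin N) (k : ℕ) :
    (partialDeriv i)^[k] (f + g) = (partialDeriv i)^[k] f + (partialDeriv i)^[k] g := by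
  induction k generalizing f g with
  | zero => rfl
  | succ k ih =>
    simp only [Function.iterate_succ_apply, partialDeriv_add hf hg]
    exact ih (contDiff_partialDeriv hf i) (contDiff_partialDeriv hg i)

theorem iterate_partialDeriv_const_mul (c : ℝ) (f : (Fin N → ℝ) → ℝ) (i : Fin N) (k : ℕ) :
    (partialDeriv i)^[k] (fun x => c * f x) = fun x => c * (partialDeriv i)^[k] f x := by
  induction k generalizing f with
  | zero => rfl
  | succ k ih => simp only [Function.iterate_succ_apply, partialDeriv_const_mul, ih]

/-! ### Splitting off pure derivatives along coordinate lines -/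

theorem contDiff_update {E : Type} [NormedAddCommGroup E] [NormedSpace ℝ E]
    {f : E → Fin N → ℝ} {h : E → ℝ} (hf : ContDiff ℝ ∞ f) (hh : ContDiff ℝ ∞ h) (i : Fin N) :
    ContDiff ℝ ∞ (fun x => Function.update (f x) i (h x)) := by
  rw [contDiff_pi]
  intro j
  by_cases hj : j = i
  · subst hj
    simpa using hh
  · simpa [hj] using (contDiff_pi.1 hf) j

theorem exists_bump : ∃ ρ : ℝ → ℝ, ContDiff ℝ ∞ ρ ∧ (∀ t, t ∉ Icc (1 / 4 : ℝ) (3 / 4) → ρ t = 0) ∧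
    ∫ t in (0 : ℝ)..1, ρ t = 1 := by
  let b : ContDiffBump (1 / 2 : ℝ) := ⟨1 / 8, 1 / 4, by norm_num, by norm_num⟩
  have hsupp : Function.support (b.normed volume) ⊆ Icc (1 / 4 : ℝ) (3 / 4) := by
    rw [b.support_normed_eq, Real.ball_eq_Ioo]
    refine Ioo_subset_Icc_self.trans (Icc_subset_Icc ?_ ?_) <;> norm_num [b]
  refine ⟨b.normed volume, b.contDiff_normed, fun t ht => ?_, ?_⟩
  · by_contra h
    exact ht (hsupp h)
  · rw [intervalIntegral.integral_eq_integral_of_support_subset, b.integral_normed]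
    refine hsupp.trans fun t ht => ⟨?_, ?_⟩ <;> [linarith [ht.1]; linarith [ht.2]]

theorem iterate_partialDeriv_mul_comp {a : (Fin N → ℝ) → ℝ} {i : Fin N}
    (ha : ∀ x t, a (Function.update x i t) = a x) (ρ : ℝ → ℝ) (m : ℕ) :
    (partialDeriv i)^[m] (fun x => a x * ρ (x i)) = fun x => a x * iteratedDeriv m ρ (x i) := by
  induction m with
  | zero => simp
  | succ m ih =>
    rw [Function.iterate_succ_apply', ih]
    ext x
    simp [partialDeriv, ha, iteratedDeriv_succ]

/-- The error is `η = a(x) ρ(x_i)`, where `a` is the integral of `ψ` along the line in direction `i`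
and `ρ` is a bump of integral one. As `a` does not depend on `x_i`, the derivatives `∂_i^m` fall on
`ρ` alone, so no derivative of `ψ` enters the bound. Since `ρ` is fixed, `R` does not depend on `δ`;
the condition `δ ≤ 1/4` keeps the support of `ρ` inside the box. -/
theorem exists_partialDeriv_add (i : Fin N) (m : ℕ) : ∃ R : ℝ, 0 ≤ R ∧
    ∀ (δ M : ℝ) (ψ : (Fin N → ℝ) → ℝ), 0 < δ → δ ≤ 1 / 4 → SmoothInBox δ ψ → (∀ x, |ψ x| ≤ M) →
      ∃ φ η, SmoothInBox δ φ ∧ SmoothInBox δ η ∧ ψ = partialDeriv i φ + η ∧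
        (∀ x, |φ x| ≤ R * M) ∧ ∀ x, |(partialDeriv i)^[m] η x| ≤ R * M := by
  obtain ⟨ρ, hρ, hρ0, hρ1⟩ := exists_bump
  obtain ⟨R₀, hR₀⟩ := (isCompact_Icc (a := (0 : ℝ)) (b := 1)).exists_bound_of_continuousOn
    hρ.continuous.continuousOn
  obtain ⟨R₁, hR₁⟩ := (isCompact_Icc (a := (0 : ℝ)) (b := 1)).exists_bound_of_continuousOn
    (hρ.continuous_iteratedDeriv m (by exact_mod_cast le_top)).continuousOn
  have hR₀' : 0 ≤ R₀ := (norm_nonneg _).trans (hR₀ 0 (by simp))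
  have hR₁' : 0 ≤ R₁ := (norm_nonneg _).trans (hR₁ 0 (by simp))
  -- `1 + R₀` bounds `ψ - η`, hence its primitive on the unit interval; `R₁` bounds the `m`-th
  -- derivative of the bump.
  refine ⟨1 + R₀ + R₁, by positivity, fun δ M ψ hδ hδ' hψ hM => ?_⟩
  have hM0 : 0 ≤ M := (abs_nonneg _).trans (hM 0)
  set a : (Fin N → ℝ) → ℝ := fun x => ∫ t in (0 : ℝ)..1, ψ (Function.update x i t) with ha
  have ha_upd : ∀ x t, a (Function.update x i t) = a x := fun x t => by simp [ha]
  have ha_smooth : ContDiff ℝ ∞ a :=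
    contDiff_intervalIntegral (f := fun x t => ψ (Function.update x i t))
      (hψ.1.comp (contDiff_update contDiff_fst contDiff_snd i))
  have ha_le : ∀ x, |a x| ≤ M := fun x => by
    have := intervalIntegral.norm_integral_le_of_norm_le_const (a := (0 : ℝ)) (b := 1) (C := M)
      (f := fun t => ψ (Function.update x i t)) fun t _ => hM _
    simpa using this
  set η : (Fin N → ℝ) → ℝ := fun x => a x * ρ (x i) with hη
  have hη_box : SmoothInBox δ η := by
    refine ⟨ha_smooth.mul (hρ.comp (contDiff_apply ℝ ℝ i)), fun x j hj => ?_⟩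
    by_cases hji : j = i
    · subst hji
      have : ρ (x j) = 0 := hρ0 _ fun h => hj ⟨by linarith [h.1], by linarith [h.2]⟩
      simp [hη, this]
    · have : a x = 0 := by
        simp only [ha]
        refine intervalIntegral.integral_zero_ae (Eventually.of_forall fun t _ => ?_)
        exact hψ.2 _ j (by simpa [hji] using hj)
      simp [hη, this]
  have hη_le : ∀ x, |η x| ≤ M * R₀ := fun x => by
    by_cases hx : x i ∈ Icc δ (1 - δ)
    · rw [hη, abs_mul]
      exact mul_le_mul (ha_le x) (hR₀ _ ⟨by linarith [hx.1], by linarith [hx.2]⟩)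
        (abs_nonneg _) hM0
    · rw [hη_box.2 x i hx, abs_zero]; positivity
  set g : (Fin N → ℝ) → ℝ := fun x => ψ x - η x with hg
  have hg_box : SmoothInBox δ g :=
    ⟨hψ.1.sub hη_box.1, fun x j hj => by simp [hg, hψ.2 x j hj, hη_box.2 x j hj]⟩
  have hslice : ∀ x, Continuous fun t => g (Function.update x i t) := fun x =>
    hg_box.1.continuous.comp (continuous_const.update i continuous_id)
  -- The primitive from `0` to `x i`, rescaled to the fixed interval `[0,1]` so that smoothness in
  -- `x` follows from `contDiff_intervalIntegral`.
  set φ : (Fin N → ℝ) → ℝ :=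
    fun x => x i * ∫ t in (0 : ℝ)..1, g (Function.update x i (x i * t)) with hφ
  have hφ_eq : ∀ x, φ x = ∫ t in (0 : ℝ)..x i, g (Function.update x i t) := fun x => by
    have := intervalIntegral.mul_integral_comp_mul_left (a := 0) (b := 1)
      (f := fun t => g (Function.update x i t)) (x i)
    simpa [hφ] using this
  have hφ_smooth : ContDiff ℝ ∞ φ := by
    refine (contDiff_apply ℝ ℝ i).mul
      (contDiff_intervalIntegral (f := fun x t => g (Function.update x i (x i * t))) ?_)
    exact hg_box.1.comp (contDiff_update contDiff_fst
      (((contDiff_apply ℝ ℝ i).comp contDiff_fst).mul contDiff_snd) i)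
  have hzero : ∀ x, ∫ t in (0 : ℝ)..1, g (Function.update x i t) = 0 := fun x => by
    have h1 : Continuous fun t => ψ (Function.update x i t) :=
      hψ.1.continuous.comp (continuous_const.update i continuous_id)
    have h2 : Continuous fun t => a x * ρ t := continuous_const.mul hρ.continuous
    simp only [hg, hη, ha_upd, Function.update_self]
    rw [intervalIntegral.integral_sub (h1.intervalIntegrable _ _)
      (h2.intervalIntegrable _ _),
      intervalIntegral.integral_const_mul, hρ1]
    simp [ha]
  have hφ_box : SmoothInBox δ φ := by
    refine ⟨hφ_smooth, fun x j hj => ?_⟩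
    rw [hφ_eq]
    by_cases hji : j = i
    · subst hji
      rcases not_and_or.1 hj with h | h
      · refine intervalIntegral.integral_zero_ae (Eventually.of_forall fun t ht => ?_)
        refine hg_box.2 _ j fun ht' => ?_
        rw [Function.update_self] at ht'
        have := ht.2.trans_lt (max_lt hδ (not_le.1 h))
        linarith [ht'.1]
      -- To the right of the box, the zero mean lets the primitive be computed from `1` instead of
      -- `0`, over a range where `g` vanishes.
      · rw [← intervalIntegral.integral_add_adjacent_intervals (b := 1)
          ((hslice x).intervalIntegrable _ _) ((hslice x).intervalIntegrable _ _), hzero, zero_add]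
        refine intervalIntegral.integral_zero_ae (Eventually.of_forall fun t ht => ?_)
        refine hg_box.2 _ j fun ht' => ?_
        rw [Function.update_self] at ht'
        have := (lt_min (by linarith) (not_le.1 h) : 1 - δ < min 1 (x j)).trans ht.1
        linarith [ht'.2]
    · refine intervalIntegral.integral_zero_ae (Eventually.of_forall fun t _ => ?_)
      exact hg_box.2 _ j (by simpa [hji] using hj)
  refine ⟨φ, η, hφ_box, hη_box, ?_, fun x => ?_, fun x => ?_⟩
  · ext x
    have h : HasDerivAt (fun t => φ (Function.update x i t)) (g x) (x i) := by
      simp only [hφ_eq, Function.update_self, Function.update_idem]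
      simpa using intervalIntegral.integral_hasDerivAt_right
        ((hslice x).intervalIntegrable 0 (x i))
        (hslice x).stronglyMeasurable.stronglyMeasurableAtFilter (hslice x).continuousAt
    have h' : partialDeriv i φ x = g x := h.deriv
    simp [h', hg]
  · by_cases hx : x i ∈ Icc δ (1 - δ)
    · have := intervalIntegral.norm_integral_le_of_norm_le_const (a := (0 : ℝ)) (b := x i)
        (C := M + M * R₀) (f := fun t => g (Function.update x i t))
        fun t _ => (abs_sub _ _).trans (add_le_add (hM _) (hη_le _))
      rw [hφ_eq]
      refine this.trans ?_
      have h0 : |x i - 0| ≤ 1 := by rw [abs_le]; constructor <;> linarith [hx.1, hx.2]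
      nlinarith [mul_le_mul_of_nonneg_left h0 (by positivity : 0 ≤ M + M * R₀),
        mul_nonneg hR₁' hM0]
    · rw [hφ_box.2 x i hx, abs_zero]; positivity
  · by_cases hx : x i ∈ Icc δ (1 - δ)
    · rw [hη, iterate_partialDeriv_mul_comp ha_upd, abs_mul]
      have h1 := mul_le_mul (ha_le x) (hR₁ (x i) ⟨by linarith [hx.1], by linarith [hx.2]⟩)
        (abs_nonneg _) hM0
      refine h1.trans ?_
      nlinarith [mul_nonneg hR₀' hM0]
    · rw [(hη_box.iterate_partialDeriv i m).2 x i hx, abs_zero]; positivity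

/-- A smooth function with compact support in the cube is a `k`-th pure derivative up to an error
whose derivative in the same direction is controlled by the supremum norm. -/
theorem exists_iterate_partialDeriv_add (i : Fin N) (k : ℕ) : ∃ R : ℝ, 0 ≤ R ∧
    ∀ (δ M : ℝ) (ψ : (Fin N → ℝ) → ℝ), 0 < δ → δ ≤ 1 / 4 → SmoothInBox δ ψ → (∀ x, |ψ x| ≤ M) →
      ∃ φ η, SmoothInBox δ φ ∧ SmoothInBox δ η ∧ ψ = (partialDeriv i)^[k] φ + η ∧
        (∀ x, |φ x| ≤ R * M) ∧ ∀ x, |partialDeriv i η x| ≤ R * M := by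
  induction k with
  | zero =>
    refine ⟨1, zero_le_one, fun δ M ψ _ _ hψ hM => ⟨ψ, 0, hψ, .zero δ, by simp, by simpa, ?_⟩⟩
    intro x
    simpa [partialDeriv_zero] using (abs_nonneg _).trans (hM 0)
  | succ k ih =>
    obtain ⟨R, hR, h⟩ := ih
    -- The new error enters as `∂_i^k η'`, and one further derivative of it must be bounded: hence
    -- order `k + 1`.
    obtain ⟨S, hS, h'⟩ := exists_partialDeriv_add i (k + 1)
    refine ⟨R + S * R, by positivity, fun δ M ψ hδ hδ' hψ hM => ?_⟩
    have hM0 : 0 ≤ M := (abs_nonneg _).trans (hM 0)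
    obtain ⟨φ, η, hφ, hη, hψe, hφM, hηM⟩ := h δ M ψ hδ hδ' hψ hM
    obtain ⟨φ', η', hφ', hη', hφe, hφM', hηM'⟩ := h' δ (R * M) φ hδ hδ' hφ hφM
    have hpos := mul_nonneg hR hM0
    refine ⟨φ', (partialDeriv i)^[k] η' + η, hφ', (hη'.iterate_partialDeriv i k).add hη, ?_,
      fun x => (hφM' x).trans ?_, fun x => ?_⟩
    · conv_lhs => rw [hψe, hφe, iterate_partialDeriv_add (hφ'.partialDeriv i).1 hη'.1]
      rw [← Function.iterate_succ_apply, add_assoc]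
    · nlinarith
    · rw [partialDeriv_add (hη'.iterate_partialDeriv i k).1 hη.1,
        ← Function.iterate_succ_apply' (partialDeriv i)]
      refine (abs_add_le _ _).trans ((add_le_add (hηM' x) (hηM x)).trans (le_of_eq ?_))
      ring

/-! ### The Riemann–Liouville derivative of smooth compactly supported functions -/

section RiemannLiouville

variable {δ s : ℝ} {f g : (Fin N → ℝ) → ℝ}

/-- The substitution `t = y + τ` removes `y` from the singular kernel, and the vanishing of `w`
beyond `1` allows the upper limit to be fixed at `1`. Differentiation under the integral is then
dominated by `A τ^(-s)`. -/
theorem rlDerivRight_eq {w w' : ℝ → ℝ} (hw : ∀ t, HasDerivAt w (w' t) t) (hw' : Continuous w')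
    {A : ℝ} (hA : ∀ t, |w' t| ≤ A) (hw0 : ∀ t, 1 ≤ t → w t = 0) (hs : s < 1)
    {x : ℝ} (hx : x ∈ Ioo (0 : ℝ) 1) :
    rlDerivRight s w x =
      -(1 / Real.Gamma (1 - s)) * ∫ τ in (0 : ℝ)..1, w' (x + τ) * τ ^ (-s) := by
  have hwc : Continuous w := continuous_iff_continuousAt.2 fun t => (hw t).continuousAt
  have hpow : ∀ a b : ℝ, IntervalIntegrable (fun τ : ℝ => τ ^ (-s)) volume a b := fun a b =>
    intervalIntegral.intervalIntegrable_rpow' (by linarith)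
  have hint : ∀ {h : ℝ → ℝ}, Continuous h → ∀ y a b : ℝ,
      IntervalIntegrable (fun τ : ℝ => h (y + τ) * τ ^ (-s)) volume a b := fun hh y a b =>
    (hpow a b).continuousOn_mul (hh.comp (continuous_const_add y)).continuousOn
  have heq : (fun y : ℝ => ∫ t in y..1, w t / (t - y) ^ s) =ᶠ[𝓝 x]
      fun y => ∫ τ in (0 : ℝ)..1, w (y + τ) * τ ^ (-s) := by
    filter_upwards [Ioo_mem_nhds hx.1 hx.2] with y hy
    have h1 := intervalIntegral.integral_comp_add_left (a := 0) (b := 1 - y)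
      (fun t => w t / (t - y) ^ s) y
    simp only [add_zero, add_sub_cancel, add_sub_cancel_left] at h1
    rw [← h1, ← intervalIntegral.integral_add_adjacent_intervals (b := 1 - y) (hint hwc y _ _)
      (hint hwc y _ _)]
    have h2 : ∫ τ in (1 - y)..1, w (y + τ) * τ ^ (-s) = 0 := by
      refine intervalIntegral.integral_zero_ae (Eventually.of_forall fun τ hτ => ?_)
      rw [uIoc_of_le (by linarith [hy.1])] at hτ
      rw [hw0 _ (by linarith [hτ.1]), zero_mul]
    rw [h2, add_zero]
    refine intervalIntegral.integral_congr fun τ hτ => ?_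
    rw [uIcc_of_le (by linarith [hy.2])] at hτ
    simp only [Real.rpow_neg hτ.1, div_eq_mul_inv]
  have hder := (intervalIntegral.hasDerivAt_integral_of_dominated_loc_of_deriv_le
    (μ := volume) (a := 0) (b := 1) (F := fun y τ => w (y + τ) * τ ^ (-s))
    (F' := fun y τ => w' (y + τ) * τ ^ (-s)) (x₀ := x) (bound := fun τ => A * τ ^ (-s))
    univ_mem (Eventually.of_forall fun y => (hint hwc y 0 1).def'.aestronglyMeasurable)
    (hint hwc x 0 1) (hint hw' x 0 1).def'.aestronglyMeasurable
    (Eventually.of_forall fun τ hτ y _ => by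
      rw [uIoc_of_le zero_le_one] at hτ
      have h0 : 0 ≤ τ ^ (-s) := Real.rpow_nonneg hτ.1.le _
      rw [Real.norm_eq_abs, abs_mul, abs_of_nonneg h0]
      exact mul_le_mul_of_nonneg_right (hA _) h0)
    ((hpow 0 1).const_mul A)
    (Eventually.of_forall fun τ _ y _ =>
      ((hw (y + τ)).comp_add_const y τ).mul_const _)).2
  rw [rlDerivRight, heq.deriv_eq, hder.deriv]

namespace SmoothInBox

theorem fracPartialDerivRight_eq (hf : SmoothInBox δ f) (hδ : 0 < δ) (hs : s < 1) (i : Fin N)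
    {x : Fin N → ℝ} (hx : x ∈ unitCube N) :
    fracPartialDerivRight s i f x = -(1 / Real.Gamma (1 - s)) *
      ∫ τ in (0 : ℝ)..1, FracTV.partialDeriv i f (Function.update x i (x i + τ)) * τ ^ (-s) := by
  obtain ⟨A, hA⟩ := (hf.partialDeriv i).exists_bound
  exact rlDerivRight_eq (hasDerivAt_comp_update hf.1 i x)
    ((hf.partialDeriv i).1.continuous.comp (continuous_const.update i continuous_id))
    (fun t => hA _) (fun t ht => hf.2 _ i fun h => by
      rw [Function.update_self] at h; linarith [h.2]) hs (hx i)

theorem intervalIntegrable (hf : SmoothInBox δ f) (hs : s < 1) (i : Fin N) (x : Fin N → ℝ) :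
    IntervalIntegrable (fun τ : ℝ =>
      FracTV.partialDeriv i f (Function.update x i (x i + τ)) * τ ^ (-s)) volume 0 1 :=
  (intervalIntegral.intervalIntegrable_rpow' (by linarith)).continuousOn_mul
    ((hf.partialDeriv i).1.continuous.comp
      (continuous_const.update i (continuous_const_add (x i)))).continuousOn

theorem fracPartialDerivRight_add (hf : SmoothInBox δ f) (hg : SmoothInBox δ g) (hδ : 0 < δ)
    (hs : s < 1) (i : Fin N) {x : Fin N → ℝ} (hx : x ∈ unitCube N) :
    fracPartialDerivRight s i (f + g) x =
      fracPartialDerivRight s i f x + fracPartialDerivRight s i g x := by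
  rw [(hf.add hg).fracPartialDerivRight_eq hδ hs i hx, hf.fracPartialDerivRight_eq hδ hs i hx,
    hg.fracPartialDerivRight_eq hδ hs i hx, partialDeriv_add hf.1 hg.1, ← mul_add,
    ← intervalIntegral.integral_add (hf.intervalIntegrable hs i x) (hg.intervalIntegrable hs i x)]
  simp only [Pi.add_apply, add_mul]

theorem fracPartialDerivRight_const_mul (hf : SmoothInBox δ f) (hδ : 0 < δ)
    (hs : s < 1) (c : ℝ) (i : Fin N) {x : Fin N → ℝ} (hx : x ∈ unitCube N) :
    fracPartialDerivRight s i (fun y => c * f y) x = c * fracPartialDerivRight s i f x := by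
  rw [(hf.const_mul c).fracPartialDerivRight_eq hδ hs i hx, hf.fracPartialDerivRight_eq hδ hs i hx,
    partialDeriv_const_mul]
  simp only [mul_assoc, intervalIntegral.integral_const_mul]
  ring

/-- The kernel has mass `1 / (1 - s)`, and `(1 - s) Γ(1 - s) = Γ(2 - s)` absorbs it, so the bound
does not degenerate as `s → 1`. -/
theorem abs_fracPartialDerivRight_le (hf : SmoothInBox δ f) (hδ : 0 < δ) (hs : s < 1) (i : Fin N)
    {A : ℝ} (hA : ∀ x, |FracTV.partialDeriv i f x| ≤ A) {x : Fin N → ℝ} (hx : x ∈ unitCube N) :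
    |fracPartialDerivRight s i f x| ≤ A / Real.Gamma (2 - s) := by
  have hΓ : 0 < Real.Gamma (1 - s) := Real.Gamma_pos_of_pos (by linarith)
  have hA0 : 0 ≤ A := (abs_nonneg _).trans (hA 0)
  have hle : |∫ τ in (0 : ℝ)..1,
      FracTV.partialDeriv i f (Function.update x i (x i + τ)) * τ ^ (-s)| ≤ A / (1 - s) := by
    have h := intervalIntegral.norm_integral_le_of_norm_le (μ := volume) zero_le_one
      (f := fun τ : ℝ => FracTV.partialDeriv i f (Function.update x i (x i + τ)) * τ ^ (-s))
      (g := fun τ => A * τ ^ (-s))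
      (Eventually.of_forall fun τ hτ => by
        have h0 : 0 ≤ τ ^ (-s) := Real.rpow_nonneg hτ.1.le _
        rw [Real.norm_eq_abs, abs_mul, abs_of_nonneg h0]
        exact mul_le_mul_of_nonneg_right (hA _) h0)
      ((intervalIntegral.intervalIntegrable_rpow' (by linarith)).const_mul A)
    refine h.trans (le_of_eq ?_)
    rw [intervalIntegral.integral_const_mul, integral_rpow (Or.inl (by linarith)),
      Real.one_rpow, Real.zero_rpow (by linarith)]
    rw [show -s + 1 = 1 - s by ring]
    ring
  rw [hf.fracPartialDerivRight_eq hδ hs i hx, abs_mul, abs_neg, abs_of_pos (by positivity),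
    show 2 - s = (1 - s) + 1 by ring, Real.Gamma_add_one (by linarith)]
  refine (mul_le_mul_of_nonneg_left hle (by positivity)).trans (le_of_eq ?_)
  field_simp

end SmoothInBox

theorem measurableSet_unitCube (N : ℕ) : MeasurableSet (unitCube N) := by
  have : unitCube N = Set.pi univ fun _ => Ioo (0 : ℝ) 1 := by ext; simp [unitCube]
  rw [this]
  exact MeasurableSet.univ_pi fun _ => measurableSet_Ioo

theorem SmoothInBox.aestronglyMeasurable (hf : SmoothInBox δ f) (hδ : 0 < δ) (hs : s < 1)
    (i : Fin N) : AEStronglyMeasurable (fracPartialDerivRight s i f)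
      (volume.restrict (unitCube N)) := by
  have h : StronglyMeasurable fun x : Fin N → ℝ => -(1 / Real.Gamma (1 - s)) *
      ∫ τ in (0 : ℝ)..1, FracTV.partialDeriv i f (Function.update x i (x i + τ)) * τ ^ (-s) := by
    refine StronglyMeasurable.const_mul ?_ _
    simp only [intervalIntegral.integral_of_le zero_le_one]
    refine StronglyMeasurable.integral_prod_right (f := fun (x : Fin N → ℝ) (τ : ℝ) =>
      FracTV.partialDeriv i f (Function.update x i (x i + τ)) * τ ^ (-s)) (Measurable.stronglyMeasurable ?_)
    have h1 : Continuous fun q : (Fin N → ℝ) × ℝ =>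
        FracTV.partialDeriv i f (Function.update q.1 i (q.1 i + q.2)) :=
      (hf.partialDeriv i).1.continuous.comp
        (continuous_fst.update i (((continuous_apply i).comp continuous_fst).add continuous_snd))
    exact h1.measurable.mul (measurable_snd.pow_const _)
  refine h.aestronglyMeasurable.congr ?_
  filter_upwards [ae_restrict_mem (measurableSet_unitCube N)] with x hx
  exact (hf.fracPartialDerivRight_eq hδ hs i hx).symm

theorem exists_le_Gamma : ∃ c : ℝ, 0 < c ∧ ∀ s : ℝ, 0 < s → s < 1 → c ≤ Real.Gamma (2 - s) := by
  obtain ⟨c, hc, h⟩ := (isCompact_Icc (a := (1 : ℝ)) (b := 2)).exists_forall_le'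
    (f := Real.Gamma) (a := 0)
    (fun x hx => (Real.differentiableAt_Gamma fun m => by
      have : (0 : ℝ) ≤ m := m.cast_nonneg
      linarith [hx.1]).continuousAt.continuousWithinAt)
    (fun x hx => Real.Gamma_pos_of_pos (by linarith [hx.1]))
  exact ⟨c, hc, fun s hs0 hs1 => h _ ⟨by linarith, by linarith⟩⟩

/-! ### Diagonal tensor fields and dual norms -/

/-- Contracting the last index of a diagonal field leaves only the term `l = a.1`, and the result is
the diagonal field of the `∂_i g_i`, one order lower. -/
theorem divIter_diagonal (k : ℕ) (g : Fin N → (Fin N → ℝ) → ℝ) (x : Fin N → ℝ) (i : Fin N) :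
    divIter k (fun x a => if a.2 = fun _ => a.1 then g a.1 x else 0) x i =
      (partialDeriv i)^[k] (g i) x := by
  induction k generalizing g with
  | zero => simp [divIter, funext_iff]
  | succ k ih =>
    rw [Function.iterate_succ_apply, ← ih fun i => partialDeriv i (g i), divIter]
    congr 1
    ext x a
    have hsnoc : ∀ l, ((Fin.snoc a.2 l : Fin (k + 1) → Fin N) = fun _ => a.1) ↔
        l = a.1 ∧ a.2 = fun _ => a.1 := by
      intro l
      simp only [funext_iff, Fin.forall_fin_succ', Fin.snoc_castSucc, Fin.snoc_last]
      tauto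
    simp only [hsnoc]
    by_cases ha : a.2 = fun _ => a.1
    · rw [Finset.sum_eq_single a.1]
      · simp [ha]
      · intro l _ hl
        simp [hl, partialDeriv]
      · simp
    · simp [ha, partialDeriv]

section DualNorm

variable {ι : Type} [Fintype ι] (p : ℝ≥0∞) [Fact (1 ≤ p)] (y : ι → ℝ)

theorem sum_mul_le_sum_abs {x : PiLp p (fun _ : ι => ℝ)} (hx : x ∈ Metric.closedBall 0 1) :
    ∑ i, x i * y i ≤ ∑ i, |y i| := by
  refine Finset.sum_le_sum fun i _ => (le_abs_self _).trans ?_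
  rw [abs_mul]
  have h : |x i| ≤ 1 := (PiLp.norm_apply_le x i).trans (by simpa using hx)
  exact mul_le_of_le_one_left (abs_nonneg _) h

/-- For every `p`, points of the `ℓ^p` unit ball have coordinates in `[-1, 1]`. This and
`abs_apply_le_dualNorm` are the only facts about `p` needed, which keeps the constants free of `p`.
-/
theorem dualNorm_le_sum_abs : dualNorm p y ≤ ∑ i, |y i| := by
  refine csSup_le (Set.Nonempty.image _ ⟨0, by simp⟩) ?_
  rintro _ ⟨x, hx, rfl⟩
  exact sum_mul_le_sum_abs p y hx

theorem abs_apply_le_dualNorm (i : ι) : |y i| ≤ dualNorm p y := by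
  classical
  have hbdd : BddAbove ((fun x : PiLp p (fun _ : ι => ℝ) => ∑ i, x i * y i) ''
      Metric.closedBall 0 1) := by
    refine ⟨∑ i, |y i|, ?_⟩
    rintro _ ⟨x, hx, rfl⟩
    exact sum_mul_le_sum_abs p y hx
  have h : ∀ c : ℝ, |c| ≤ 1 → c * y i ≤ dualNorm p y := fun c hc =>
    le_csSup hbdd ⟨PiLp.single p i c, by simpa [PiLp.norm_single] using hc, by simp⟩
  rw [abs_le']
  exact ⟨by simpa using h 1 (by simp), by simpa using h (-1) (by simp)⟩

end DualNorm

theorem exists_smoothInBox {ι : Type} [Fintype ι] {φ : (Fin N → ℝ) → ι → ℝ} (hφ : ContDiff ℝ ∞ φ)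
    (hc : HasCompactSupport φ) (hsub : tsupport φ ⊆ unitCube N) :
    ∃ δ, 0 < δ ∧ δ ≤ 1 / 4 ∧ ∀ a, SmoothInBox δ fun x => φ x a := by
  have hev : ∀ j : Fin N, ∀ᶠ δ in 𝓝[>] (0 : ℝ), ∀ x ∈ tsupport φ, x j ∈ Icc δ (1 - δ) := by
    intro j
    obtain ⟨c, hc0, h⟩ := hc.isCompact.exists_forall_le' (f := fun x => min (x j) (1 - x j)) (a := 0)
      (by fun_prop) (fun x hx => lt_min (hsub hx j).1 (by linarith [(hsub hx j).2]))
    filter_upwards [Ioc_mem_nhdsGT hc0] with δ hδ x hx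
    have := le_min_iff.1 (hδ.2.trans (h x hx))
    exact ⟨this.1, by linarith [this.2]⟩
  obtain ⟨δ, hδ, hδ'⟩ := ((eventually_all.2 hev).and
    (Ioc_mem_nhdsGT (show (0 : ℝ) < 1 / 4 by norm_num))).exists
  refine ⟨δ, hδ'.1, hδ'.2, fun a => ⟨contDiff_pi.1 hφ a, fun x j hj => ?_⟩⟩
  have : φ x = 0 := by
    by_contra h
    exact hj (hδ j x (subset_tsupport φ h))
  simp [this]

end RiemannLiouville

/-! ### Estimates for the fractional divergence and decomposition of test fields -/

theorem SmoothInBox.integrableOn_mul {δ s : ℝ} {f u : (Fin N → ℝ) → ℝ} (hf : SmoothInBox δ f)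
    (hδ : 0 < δ) (hs : s < 1) (i : Fin N) (hu : IntegrableOn u (unitCube N)) :
    IntegrableOn (fun x => u x * fracPartialDerivRight s i f x) (unitCube N) := by
  obtain ⟨A, hA⟩ := (hf.partialDeriv i).exists_bound
  refine Integrable.mul_bdd (c := A / Real.Gamma (2 - s)) hu (hf.aestronglyMeasurable hδ hs i) ?_
  filter_upwards [ae_restrict_mem (measurableSet_unitCube N)] with x hx
  exact hf.abs_fracPartialDerivRight_le hδ hs i hA hx

theorem integrableOn_mul_fracDiv {δ s : ℝ} {F : (Fin N → ℝ) → Fin N → ℝ} {u : (Fin N → ℝ) → ℝ}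
    (hF : ∀ i, SmoothInBox δ fun x => F x i) (hδ : 0 < δ) (hs : s < 1)
    (hu : IntegrableOn u (unitCube N)) :
    IntegrableOn (fun x => u x * fracDiv s F x) (unitCube N) := by
  have h := (integrable_finsetSum Finset.univ fun i _ =>
    (hF i).integrableOn_mul hδ hs i hu).const_mul ((1 - 1 / (N : ℝ)) * s + 1 / (N : ℝ))
  refine Integrable.congr h (Eventually.of_forall fun x => ?_)
  simp only [fracDiv, Finset.mul_sum]
  exact Finset.sum_congr rfl fun i _ => by ring

theorem fracDiv_const_mul_add {δ s : ℝ} {F G : (Fin N → ℝ) → Fin N → ℝ}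
    (hF : ∀ i, SmoothInBox δ fun x => F x i) (hG : ∀ i, SmoothInBox δ fun x => G x i)
    (hδ : 0 < δ) (hs : s < 1) (c : ℝ) {x : Fin N → ℝ} (hx : x ∈ unitCube N) :
    fracDiv s (fun y i => c * F y i + G y i) x = c * fracDiv s F x + fracDiv s G x := by
  have h : ∀ i, fracPartialDerivRight s i (fun y => c * F y i + G y i) x =
      c * fracPartialDerivRight s i (fun y => F y i) x +
        fracPartialDerivRight s i (fun y => G y i) x := fun i => by
    rw [← (hF i).fracPartialDerivRight_const_mul hδ hs c i hx,
      ← ((hF i).const_mul c).fracPartialDerivRight_add (hG i) hδ hs i hx]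
    rfl
  simp only [fracDiv, h, Finset.sum_add_distrib, ← Finset.mul_sum]
  ring

theorem abs_fracDiv_le {δ s A c : ℝ} {F : (Fin N → ℝ) → Fin N → ℝ} (hN : 1 ≤ N)
    (hF : ∀ i, SmoothInBox δ fun x => F x i) (hA : ∀ i x, |partialDeriv i (fun y => F y i) x| ≤ A)
    (hδ : 0 < δ) (hs0 : 0 < s) (hs : s < 1) (hc : 0 < c) (hcs : c ≤ Real.Gamma (2 - s))
    {x : Fin N → ℝ} (hx : x ∈ unitCube N) :
    |fracDiv s F x| ≤ N * (A / c) := by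
  have hA0 : 0 ≤ A := (abs_nonneg _).trans (hA ⟨0, hN⟩ 0)
  have hN0 : (0 : ℝ) < 1 / N := by positivity
  have hN1 : 1 / (N : ℝ) ≤ 1 := by
    rw [div_le_one (by positivity)]
    exact_mod_cast hN
  have hκ0 : 0 ≤ (1 - 1 / (N : ℝ)) * s + 1 / (N : ℝ) := by nlinarith
  have hκ1 : (1 - 1 / (N : ℝ)) * s + 1 / (N : ℝ) ≤ 1 := by nlinarith
  have hsum : |∑ i, fracPartialDerivRight s i (fun y => F y i) x| ≤ N * (A / c) := by
    refine (Finset.abs_sum_le_sum_abs _ _).trans ((Finset.sum_le_sum fun i _ =>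
      ((hF i).abs_fracPartialDerivRight_le hδ hs i (hA i) hx).trans
        (div_le_div_of_nonneg_left hA0 hc hcs)).trans ?_)
    simp
  rw [fracDiv, abs_mul, abs_of_nonneg hκ0]
  exact (mul_le_of_le_one_left (abs_nonneg _) hκ1).trans hsum

theorem isTestField_diagonal {k : ℕ} {δ r : ℝ} (p : ℝ≥0∞) [Fact (1 ≤ p)]
    {φ : Fin N → (Fin N → ℝ) → ℝ} (hφ : ∀ i, SmoothInBox δ (φ i)) (hδ : 0 < δ)
    (hr : ∀ i x, |φ i x| ≤ r) (hNr : N * r ≤ 1) :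
    IsTestField p k fun x a => if a.2 = fun _ => a.1 then φ a.1 x else 0 := by
  have hbox : ∀ x j, x j ∉ Icc δ (1 - δ) →
      (fun a : TensorIndex N k => if a.2 = fun _ => a.1 then φ a.1 x else 0) = 0 := by
    intro x j hj
    ext a
    simp [(hφ a.1).2 x j hj]
  have hts : tsupport (fun (x : Fin N → ℝ) (a : TensorIndex N k) =>
      if a.2 = fun _ => a.1 then φ a.1 x else 0) ⊆ Icc (fun _ => δ) (fun _ => 1 - δ) := by
    refine closure_minimal (fun x hx => ?_) isClosed_Icc
    have h : ∀ j, x j ∈ Icc δ (1 - δ) := fun j => by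
      by_contra hj
      exact hx (hbox x j hj)
    exact ⟨fun j => (h j).1, fun j => (h j).2⟩
  refine ⟨contDiff_pi.2 fun a => ?_, isCompact_Icc.of_isClosed_subset (isClosed_tsupport _) hts,
    fun x hx j => ?_, fun x => ?_⟩
  · by_cases ha : a.2 = fun _ => a.1
    · simpa [ha] using (hφ a.1).1
    · simpa [ha] using contDiff_const
  · have h := hts hx
    exact ⟨hδ.trans_le (h.1 j), (h.2 j).trans_lt (by linarith)⟩
  · refine (dualNorm_le_sum_abs p _).trans (le_trans ?_ hNr)
    rw [Fintype.sum_prod_type]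
    have : ∀ i : Fin N, ∑ j : Fin k → Fin N,
        |if j = (fun _ => i) then φ i x else 0| = |φ i x| := fun i => by
      simp [apply_ite abs]
    simp only [this]
    exact (Finset.sum_le_sum fun i _ => hr i x).trans (by simp)

/-- Up to a field with bounded diagonal derivatives, every test field of order zero is a multiple
of the iterated divergence of a test field. -/
theorem exists_divIter_add (hN : 1 ≤ N) (k : ℕ) : ∃ R : ℝ, 0 < R ∧
    ∀ (p : ℝ≥0∞) [Fact (1 ≤ p)] (ψ : (Fin N → ℝ) → TensorIndex N 0 → ℝ), IsTestField p 0 ψ →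
      ∃ (δ : ℝ) (Φ : (Fin N → ℝ) → TensorIndex N k → ℝ) (η : (Fin N → ℝ) → Fin N → ℝ),
        0 < δ ∧ IsTestField p k Φ ∧ (∀ i, SmoothInBox δ fun x => divIter k Φ x i) ∧
        (∀ i, SmoothInBox δ fun x => η x i) ∧
        divIter 0 ψ = (fun x i => (N * R) * divIter k Φ x i + η x i) ∧
        ∀ i x, |partialDeriv i (fun y => η y i) x| ≤ R := by
  choose r hr0 hr using fun i : Fin N => exists_iterate_partialDeriv_add i k
  -- One constant for all directions; the summand `1` makes it positive, so that `N * R` can be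
  -- inverted.
  have hle : ∀ i, r i ≤ 1 + ∑ i, r i := fun i => by
    have := Finset.single_le_sum (fun i _ => hr0 i) (Finset.mem_univ i)
    linarith
  have hR : 0 < 1 + ∑ i, r i := by
    have := Finset.sum_nonneg fun i (_ : i ∈ Finset.univ) => hr0 i
    linarith
  generalize 1 + ∑ i, r i = R at hle hR
  have hN0 : (0 : ℝ) < N := by exact_mod_cast hN
  refine ⟨R, hR, fun p _ ψ ⟨hψs, hψc, hψt, hψn⟩ => ?_⟩
  obtain ⟨δ, hδ, hδ', hψ⟩ := exists_smoothInBox hψs hψc hψt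
  choose φ η hφ hη hψe hφr hηr using fun i => hr i δ 1 (fun x => ψ x (i, Fin.elim0)) hδ hδ'
    (hψ _) fun x => (abs_apply_le_dualNorm p (ψ x) _).trans (hψn x)
  have hdiv : ∀ x i, divIter k
      (fun x a => if a.2 = fun _ => a.1 then (N * R)⁻¹ * φ a.1 x else 0) x i =
        (N * R)⁻¹ * (partialDeriv i)^[k] (φ i) x := fun x i => by
    rw [divIter_diagonal k (fun i x => (N * R)⁻¹ * φ i x), iterate_partialDeriv_const_mul]
  -- The factor `(N * R)⁻¹` makes each of the `N` diagonal entries at most `1 / N`, so their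
  -- absolute sum, and with it every dual norm, is at most `1`.
  refine ⟨δ, fun x a => if a.2 = fun _ => a.1 then (N * R)⁻¹ * φ a.1 x else 0, fun x i => η i x, hδ,
    isTestField_diagonal (r := (N : ℝ)⁻¹) p (φ := fun i x => (N * R)⁻¹ * φ i x)
      (fun i => (hφ i).const_mul _) hδ (fun i x => ?_) (by field_simp; rfl), fun i => ?_, hη, ?_,
    fun i x => (hηr i x).trans (by simpa using hle i)⟩
  · rw [abs_mul, abs_of_pos (by positivity)]
    calc (N * R)⁻¹ * |φ i x| ≤ (N * R)⁻¹ * R := by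
          gcongr
          exact (hφr i x).trans (by simpa using hle i)
      _ = (N : ℝ)⁻¹ := by field_simp
  · simp only [hdiv]
    exact ((hφ i).iterate_partialDeriv i k).const_mul _
  · ext x i
    rw [hdiv, mul_inv_cancel_left₀ (by positivity)]
    exact congrFun (hψe i) x

end FracTV

/-! ### The main estimate -/

theorem proposition4p9 (N : ℕ) (hN : 1 ≤ N) (k : ℕ) :
    ∃ C : ℝ, 0 < C ∧ ∀ (p : ℝ≥0∞) [Fact (1 ≤ p)] (s : ℝ), 0 < s → s < 1 →
      ∀ u : (Fin N → ℝ) → ℝ, FracTV.MemSV k s u →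
        FracTV.TV p 0 s u ≤
          ENNReal.ofReal C *
            (eLpNorm u 1 (volume.restrict (FracTV.unitCube N)) + FracTV.TV p k s u) := by
  obtain ⟨R, hR, hdec⟩ := FracTV.exists_divIter_add hN k
  obtain ⟨c, hc, hcΓ⟩ := FracTV.exists_le_Gamma
  have hN0 : (0 : ℝ) < N := by exact_mod_cast hN
  -- `N * (R / c)` bounds `div^s η` uniformly; `N * R` undoes the normalization of `Φ`.
  refine ⟨N * (R / c) + N * R, by positivity, fun p _ s hs0 hs u hu => ?_⟩
  obtain ⟨v, -, -, hint, -⟩ := hu p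
  refine iSup₂_le fun ψ hψ => ?_
  obtain ⟨δ, Φ, η, hδ, hΦ, hΦδ, hη, hψe, hηR⟩ := hdec p ψ hψ
  have hIΦ := FracTV.integrableOn_mul_fracDiv hΦδ hδ hs hint
  have hIη := FracTV.integrableOn_mul_fracDiv hη hδ hs hint
  have hsplit : ∫ x in FracTV.unitCube N, u x * FracTV.fracDiv s (FracTV.divIter 0 ψ) x =
      N * R * (∫ x in FracTV.unitCube N, u x * FracTV.fracDiv s (FracTV.divIter k Φ) x) +
        ∫ x in FracTV.unitCube N, u x * FracTV.fracDiv s η x := by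
    rw [← integral_const_mul, ← integral_add (hIΦ.const_mul _) hIη]
    refine setIntegral_congr_fun (FracTV.measurableSet_unitCube N) fun x hx => ?_
    rw [hψe]
    simp only [FracTV.fracDiv_const_mul_add hΦδ hη hδ hs _ hx]
    ring
  have hηle : ∫ x in FracTV.unitCube N, u x * FracTV.fracDiv s η x ≤
      N * (R / c) * ∫ x in FracTV.unitCube N, ‖u x‖ := by
    rw [← integral_const_mul]
    refine setIntegral_mono_on hIη (hint.norm.const_mul _) (FracTV.measurableSet_unitCube N)
      fun x hx => (le_abs_self _).trans ?_
    rw [abs_mul, mul_comm, Real.norm_eq_abs]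
    exact mul_le_mul_of_nonneg_right
      (FracTV.abs_fracDiv_le hN hη hηR hδ hs0 hs hc (hcΓ s hs0 hs) hx) (abs_nonneg _)
  have hu1 : ENNReal.ofReal (∫ x in FracTV.unitCube N, ‖u x‖) =
      eLpNorm u 1 (volume.restrict (FracTV.unitCube N)) := by
    rw [eLpNorm_one_eq_lintegral_enorm, ofReal_integral_norm_eq_lintegral_enorm hint]
  have hTV : ENNReal.ofReal (∫ x in FracTV.unitCube N,
      u x * FracTV.fracDiv s (FracTV.divIter k Φ) x) ≤ FracTV.TV p k s u :=
    le_iSup₂_of_le Φ hΦ le_rfl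
  calc ENNReal.ofReal (∫ x in FracTV.unitCube N, u x * FracTV.fracDiv s (FracTV.divIter 0 ψ) x)
      ≤ ENNReal.ofReal (N * R * (∫ x in FracTV.unitCube N,
          u x * FracTV.fracDiv s (FracTV.divIter k Φ) x)) +
        ENNReal.ofReal (N * (R / c) * ∫ x in FracTV.unitCube N, ‖u x‖) := by
        rw [hsplit]
        exact (ENNReal.ofReal_le_ofReal (by gcongr)).trans ENNReal.ofReal_add_le
    _ ≤ ENNReal.ofReal (N * R) * FracTV.TV p k s u + ENNReal.ofReal (N * (R / c)) *
        eLpNorm u 1 (volume.restrict (FracTV.unitCube N)) := by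
        rw [ENNReal.ofReal_mul (p := N * R) (by positivity),
          ENNReal.ofReal_mul (p := N * (R / c)) (by positivity), hu1]
        gcongr
    _ ≤ ENNReal.ofReal (N * (R / c) + N * R) *
        (eLpNorm u 1 (volume.restrict (FracTV.unitCube N)) + FracTV.TV p k s u) := by
        rw [mul_add, add_comm]
        gcongr <;> [exact le_add_of_nonneg_right (by positivity);
          exact le_add_of_nonneg_left (by positivity)]
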